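/- Let $k$ be a field and let $Q$ be a finite quiver with vertex set $Q_0$. Let $I$ be an admissible two-sided ideal of the path algebra $kQ$, that is, $\langle Q_n\rangle\subseteq I\subseteq\langle Q_2\rangle$ for some $n\ge 2$, where $Q_m$ is the set of paths of length $m$. Let $B=kQ/I$ (a bound quiver algebra). Paths are composed from right to left: $\beta\alpha$ is $\alpha$ followed by $\beta$. Let $F$ be a finite set of new arrows, with source and target maps $s,t:F\to Q_0$. Let $Q_F$ be the quiver with vertex set $Q_0$ and arrow set $Q_1\sqcup F$, and let $B_F=kQ_F/\langle I\rangle$, where $\langle I\rangle$ is the two-sided ideal of $kQ_F$ generated by $I$. Identify vertices with the corresponding idempotents of $B$. A relative path is a sequence $\gamma=(a_n,\dots,a_1)$ of $n>0$ elements of $F$ such that $s(a_{i+1})\,B\,t(a_i)\neq 0$ for $i=1,\dots,n-1$. It is a relative cycle if moreover $s(a_1)\,B\,t(a_n)\neq 0$. Assume that there are no relative cycles. For a $k$-algebra $A$ and an $A$-bimodule $Y$ (with $k$ acting centrally), let $\mathsf H_1(A,Y)$ be the first Hochschild homology, that is, the homology at $Y\otimes_k A$ of $$Y\otimes_k A\otimes_k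 A\xrightarrow{\,d_2\,} Y\otimes_k A\xrightarrow{\,d_1\,} Y,\qquad d_2(y\otimes a\otimes a')=ya\otimes a'-y\otimes aa'+a'y\otimes a,\quad d_1(y\otimes a)=ya-ay.$$ For a subalgebra $B\subseteq A$, let $\mathsf H_1(A|B,Y)$ be the first relative Hochschild homology, that is, the homology in degree $1$ of the complex given by the relative bar resolution, whose term in degree $n$ is $Y\otimes_{B\otimes_k B^{\mathrm{op}}}(A\otimes_B\cdots\otimes_B A)$ with $n$ factors $A$ (for $n=0$ it is $Y\otimes_{B\otimes_k B^{\mathrm{op}}}B$), and whose differential is induced by the formulas above. Then, for every $B_F$-bimodule $Y$ of finite dimension over $k$, the canonical maps form a short exact sequence of $k$-vector spaces $$0\to \mathsf H_1(B,Y)\to \mathsf H_1(B_F,Y)\to \mathsf H_1(B_F|B,Y)\to 0,$$ where the first map is induced by the inclusion $B\subseteq B_F$ and the second one by the projections of the Hochschild chains onto the relative chains. -/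

import Mathlib

open scoped TensorProduct

noncomputable section

/-! # Path algebras

For a finite quiver `V` and vertices `a b : V`, `Quiver.Path a b` is the type of paths from `a` to
`b`; the path of length `0` at `a` is `Quiver.Path.nil`. -/

/-- All paths of a quiver: a triple (source, target, path). -/
abbrev QuiverPath (V : Type*) [Quiver V] : Type _ := Σ a b : V, Quiver.Path a b

/-- The path algebra `kQ`: the vector space with basis the paths of the quiver. -/
def PathAlgebra (k : Type*) [Field k] (V : Type*) [Quiver V] : Type _ := QuiverPath V →₀ k

namespace PathAlgebra

section Linear

variable {k : Type*} [Field k] {V : Type*} [Quiver V]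

instance : AddCommGroup (PathAlgebra k V) := inferInstanceAs (AddCommGroup (QuiverPath V →₀ k))

instance : Module k (PathAlgebra k V) := inferInstanceAs (Module k (QuiverPath V →₀ k))

/-- The basis element of the path algebra given by a path. -/
def single (k : Type*) [Field k] {V : Type*} [Quiver V] (p : QuiverPath V) : PathAlgebra k V :=
  Finsupp.single p 1

/-- The basis element of the path algebra given by a vertex, that is, a path of length `0`. -/
def vertex (k : Type*) [Field k] {V : Type*} [Quiver V] (v : V) : PathAlgebra k V :=
  single k ⟨v, v, Quiver.Path.nil⟩

open Classical in
/-- The product `βα` of two paths: first `α`, then `β`. It is the concatenation if the target of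
`α` is the source of `β`, and `0` otherwise. -/
def pathMul (k : Type*) [Field k] {V : Type*} [Quiver V] (β α : QuiverPath V) :
    PathAlgebra k V :=
  if h : α.2.1 = β.1 then single k ⟨α.1, β.2.1, (α.2.2.cast rfl h).comp β.2.2⟩ else 0

/-- The linear map out of the path algebra with given values on the paths. -/
def extend {M : Type*} [AddCommGroup M] [Module k M] (f : QuiverPath V → M) :
    PathAlgebra k V →ₗ[k] M :=
  Finsupp.linearCombination k f

@[simp]
theorem extend_single {M : Type*} [AddCommGroup M] [Module k M] (f : QuiverPath V → M)
    (p : QuiverPath V) : extend f (single k p) = f p := by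
  exact (Finsupp.linearCombination_single k (1 : k) p).trans (one_smul k (f p))

theorem hom_ext {M : Type*} [AddCommGroup M] [Module k M] {f g : PathAlgebra k V →ₗ[k] M}
    (h : ∀ p, f (single k p) = g (single k p)) : f = g :=
  Finsupp.lhom_ext' fun p => LinearMap.ext_ring (h p)

/-- The multiplication of the path algebra, the bilinear extension of the product of paths. -/
def mulBilin : PathAlgebra k V →ₗ[k] PathAlgebra k V →ₗ[k] PathAlgebra k V :=
  extend fun β => extend fun α => pathMul k β α

instance : Mul (PathAlgebra k V) := ⟨fun x y => mulBilin x y⟩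

theorem mul_def (x y : PathAlgebra k V) : x * y = mulBilin x y := rfl

theorem single_mul_single (β α : QuiverPath V) :
    single k β * single k α = pathMul k β α := by
  simp [mul_def, mulBilin]

theorem single_mul_single_comp {a b c : V} (q : Quiver.Path b c) (p : Quiver.Path a b) :
    single k ⟨b, c, q⟩ * single k ⟨a, b, p⟩ = single k ⟨a, c, p.comp q⟩ := by
  simp [single_mul_single, pathMul]

theorem single_mul_single_of_ne {a b b' c : V} (h : b ≠ b') (q : Quiver.Path b' c)
    (p : Quiver.Path a b) :
    single k ⟨b', c, q⟩ * single k ⟨a, b, p⟩ = 0 := by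
  simp [single_mul_single, pathMul, h]

theorem mul_assoc_aux (x y z : PathAlgebra k V) : x * y * z = x * (y * z) := by
  have key : ∀ p q r : QuiverPath V,
      single k p * single k q * single k r = single k p * (single k q * single k r) := by
    rintro ⟨c', d, p⟩ ⟨b', c, q⟩ ⟨a, b, r⟩
    have l0 : ∀ w : PathAlgebra k V, 0 * w = 0 := fun w => by simp [mul_def]
    have r0 : ∀ w : PathAlgebra k V, w * 0 = 0 := fun w => by simp [mul_def]
    by_cases h₁ : c = c'
    · subst h₁
      by_cases h₂ : b = b'
      · subst h₂
        simp [single_mul_single_comp, Quiver.Path.comp_assoc]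
      · rw [single_mul_single_comp, single_mul_single_of_ne h₂, single_mul_single_of_ne h₂, r0]
    · rw [single_mul_single_of_ne h₁, l0]
      by_cases h₂ : b = b'
      · subst h₂
        rw [single_mul_single_comp, single_mul_single_of_ne h₁]
      · rw [single_mul_single_of_ne h₂, r0]
  have e : mulBilin.compr₂ (mulBilin (k := k) (V := V)) =
      ((LinearMap.llcomp k (PathAlgebra k V) (PathAlgebra k V) (PathAlgebra k V)).flip.comp
        (mulBilin (k := k) (V := V))).flip.comp mulBilin := by
    refine hom_ext fun p => hom_ext fun q => hom_ext fun r => ?_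
    exact key p q r
  exact congrArg (fun f => f x y z) e

end Linear

variable {k : Type*} [Field k] {V : Type*} [Fintype V] [Quiver V]

instance : One (PathAlgebra k V) := ⟨∑ v : V, vertex k v⟩

theorem one_def : (1 : PathAlgebra k V) = ∑ v : V, vertex k v := rfl

theorem one_mul_aux (x : PathAlgebra k V) : 1 * x = x := by
  have e : mulBilin (1 : PathAlgebra k V) = LinearMap.id := by
    refine hom_ext ?_
    rintro ⟨a, b, p⟩
    rw [← mul_def, one_def, mul_def, map_sum, LinearMap.sum_apply, Finset.sum_eq_single b]
    · rw [← mul_def, vertex, single_mul_single_comp]; rfl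
    · intro v _ hv
      rw [← mul_def, vertex, single_mul_single_of_ne hv.symm]
    · simp
  exact congrArg (fun f => f x) e

theorem mul_one_aux (x : PathAlgebra k V) : x * 1 = x := by
  have e : mulBilin.flip (1 : PathAlgebra k V) = LinearMap.id := by
    refine hom_ext ?_
    rintro ⟨a, b, p⟩
    rw [LinearMap.flip_apply, one_def, map_sum, Finset.sum_eq_single a]
    · rw [← mul_def, vertex, single_mul_single_comp, Quiver.Path.nil_comp]; rfl
    · intro v _ hv
      rw [← mul_def, vertex, single_mul_single_of_ne hv]
    · simp
  exact congrArg (fun f => f x) e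

instance : Ring (PathAlgebra k V) where
  __ := (inferInstance : AddCommGroup (PathAlgebra k V))
  mul_assoc := mul_assoc_aux
  one_mul := one_mul_aux
  mul_one := mul_one_aux
  left_distrib x y z := by simp [mul_def]
  right_distrib x y z := by simp [mul_def]
  zero_mul x := by simp [mul_def]
  mul_zero x := by simp [mul_def]

instance : Algebra k (PathAlgebra k V) :=
  Algebra.ofModule (fun r x y => by simp [mul_def]) (fun r x y => by simp [mul_def])

/-- The two-sided ideal of the path algebra generated by the paths of length `n`. -/
def lengthIdeal (k : Type*) [Field k] (V : Type*) [Fintype V] [Quiver V] (n : ℕ) :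
    TwoSidedIdeal (PathAlgebra k V) :=
  TwoSidedIdeal.span {x | ∃ (a b : V) (p : Quiver.Path a b), p.length = n ∧ x = single k ⟨a, b, p⟩}

/-- A two-sided ideal `I` of the path algebra is admissible if `⟨Q_n⟩ ⊆ I ⊆ ⟨Q_2⟩` for some
`n ≥ 2`. -/
def IsAdmissible (I : TwoSidedIdeal (PathAlgebra k V)) : Prop :=
  ∃ n : ℕ, 2 ≤ n ∧ lengthIdeal k V n ≤ I ∧ I ≤ lengthIdeal k V 2

end PathAlgebra

/-! # Adding new arrows -/

/-- The quiver `Q_F`: the vertices are those of `Q`, and the arrows are those of `Q` together with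
one arrow from `s f` to `t f` for each element `f` of `F`. -/
def AddArrows {V F : Type*} (_s _t : F → V) : Type _ := V

namespace AddArrows

variable {V F : Type*} [Quiver V] (s t : F → V)

instance : Quiver (AddArrows s t) where
  Hom a b := (Quiver.Hom (V := V) a b) ⊕ {f : F // s f = a ∧ t f = b}

instance [Fintype V] : Fintype (AddArrows s t) := inferInstanceAs (Fintype V)

/-- The inclusion of the quiver `Q` in `Q_F`. -/
def incl : V ⥤q AddArrows s t where
  obj v := v
  map e := Sum.inl e

variable (k : Type*) [Field k]

/-- The linear map `kQ → kQ_F` that sends a path of `Q` to the same path in `Q_F`. -/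
def pathInclLinear : PathAlgebra k V →ₗ[k] PathAlgebra k (AddArrows s t) :=
  PathAlgebra.extend fun p =>
    PathAlgebra.single k ⟨(incl s t).obj p.1, (incl s t).obj p.2.1, (incl s t).mapPath p.2.2⟩

theorem pathInclLinear_single {a b : V} (p : Quiver.Path a b) :
    pathInclLinear s t k (PathAlgebra.single k ⟨a, b, p⟩) =
      PathAlgebra.single k ⟨(incl s t).obj a, (incl s t).obj b, (incl s t).mapPath p⟩ := by
  simp [pathInclLinear]

theorem pathInclLinear_mul (x y : PathAlgebra k V) :
    pathInclLinear s t k (x * y) = pathInclLinear s t k x * pathInclLinear s t k y := by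
  have e : PathAlgebra.mulBilin.compr₂ (pathInclLinear s t k) =
      (PathAlgebra.mulBilin (k := k) (V := AddArrows s t)).compl₁₂
        (pathInclLinear s t k) (pathInclLinear s t k) := by
    refine PathAlgebra.hom_ext fun p => PathAlgebra.hom_ext fun q => ?_
    obtain ⟨b', c, p⟩ := p
    obtain ⟨a, b, q⟩ := q
    simp only [LinearMap.compr₂_apply, LinearMap.compl₁₂_apply, ← PathAlgebra.mul_def,
      pathInclLinear_single]
    by_cases h : b = b'
    · subst h
      rw [PathAlgebra.single_mul_single_comp, PathAlgebra.single_mul_single_comp,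
        pathInclLinear_single, Prefunctor.mapPath_comp]
    · rw [PathAlgebra.single_mul_single_of_ne h, PathAlgebra.single_mul_single_of_ne (by exact h),
        map_zero]
  exact congrArg (fun f => f x y) e

variable [Fintype V]

theorem pathInclLinear_one : pathInclLinear s t k (1 : PathAlgebra k V) = 1 := by
  rw [PathAlgebra.one_def, PathAlgebra.one_def, map_sum]
  refine Finset.sum_congr rfl fun v _ => ?_
  rw [PathAlgebra.vertex, pathInclLinear_single]
  rfl

/-- The inclusion of algebras `kQ → kQ_F`. -/
def pathIncl : PathAlgebra k V →ₐ[k] PathAlgebra k (AddArrows s t) :=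
  AlgHom.ofLinearMap (pathInclLinear s t k) (pathInclLinear_one s t k)
    (pathInclLinear_mul s t k)

end AddArrows

section Bound

variable {k : Type*} [Field k] {V : Type*} [Fintype V] [Quiver V]

/-- The algebra `B = kQ/I`. -/
abbrev QuiverAlgebra (I : TwoSidedIdeal (PathAlgebra k V)) : Type _ :=
  PathAlgebra k V ⧸ I.asIdeal

/-- The class in `B = kQ/I` of a vertex of `Q`. -/
def QuiverAlgebra.vertex (I : TwoSidedIdeal (PathAlgebra k V)) (v : V) : QuiverAlgebra I :=
  Ideal.Quotient.mk I.asIdeal (PathAlgebra.vertex k v)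

/-- The condition `vBw ≠ 0` for vertices `v` and `w`. -/
def QuiverAlgebra.Linked (I : TwoSidedIdeal (PathAlgebra k V)) (v w : V) : Prop :=
  ∃ b : QuiverAlgebra I, QuiverAlgebra.vertex I v * b * QuiverAlgebra.vertex I w ≠ 0

variable {F : Type*}

/-- A list `[a₁, …, aₙ]` of new arrows stands for the sequence `(aₙ, …, a₁)`. It is a relative path
if `n > 0` and `s(aᵢ₊₁) B t(aᵢ) ≠ 0` for `i = 1, …, n - 1`. -/
def IsRelativePath (I : TwoSidedIdeal (PathAlgebra k V)) (s t : F → V) (γ : List F) : Prop :=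
  γ ≠ [] ∧ γ.IsChain fun a b => QuiverAlgebra.Linked I (s b) (t a)

/-- A relative path `γ = (aₙ, …, a₁)` is a relative cycle if `s(γ) B t(γ) ≠ 0`, where
`s(γ) = s(a₁)` and `t(γ) = t(aₙ)`. -/
def IsRelativeCycle (I : TwoSidedIdeal (PathAlgebra k V)) (s t : F → V) (γ : List F) : Prop :=
  IsRelativePath I s t γ ∧
    ∃ h : γ ≠ [], QuiverAlgebra.Linked I (s (γ.head h)) (t (γ.getLast h))

/-- The two-sided ideal of `kQ_F` generated by the ideal `I` of `kQ`. -/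
def extendedIdeal (I : TwoSidedIdeal (PathAlgebra k V)) (s t : F → V) :
    TwoSidedIdeal (PathAlgebra k (AddArrows s t)) :=
  TwoSidedIdeal.span (AddArrows.pathIncl s t k '' (I : Set (PathAlgebra k V)))

/-- The algebra `B_F = kQ_F/⟨I⟩`. -/
abbrev ExtendedAlgebra (I : TwoSidedIdeal (PathAlgebra k V)) (s t : F → V) : Type _ :=
  QuiverAlgebra (extendedIdeal I s t)

/-- The inclusion `B → B_F`, induced by the inclusion `kQ → kQ_F`. -/
def extendedIncl (I : TwoSidedIdeal (PathAlgebra k V)) (s t : F → V) :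
    QuiverAlgebra I →ₐ[k] ExtendedAlgebra I s t :=
  Ideal.Quotient.liftₐ I.asIdeal
    ((Ideal.Quotient.mkₐ k (extendedIdeal I s t).asIdeal).comp (AddArrows.pathIncl s t k))
    (fun x hx => Ideal.Quotient.eq_zero_iff_mem.2
      (TwoSidedIdeal.subset_span ⟨x, hx, rfl⟩))

end Bound

/-! # Hochschild homology in degree one -/

section Homology

variable {k : Type*} [Field k]
  {M₂ M₁ M₀ : Type*} [AddCommGroup M₂] [Module k M₂] [AddCommGroup M₁] [Module k M₁]
  [AddCommGroup M₀] [Module k M₀]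
  {N₂ N₁ N₀ : Type*} [AddCommGroup N₂] [Module k N₂] [AddCommGroup N₁] [Module k N₁]
  [AddCommGroup N₀] [Module k N₀]

/-- The homology `Ker d₁ / Im d₂` at the middle of a complex `M₂ → M₁ → M₀`. -/
abbrev MiddleHomology (d₂ : M₂ →ₗ[k] M₁) (d₁ : M₁ →ₗ[k] M₀) : Type _ :=
  LinearMap.ker d₁ ⧸ (LinearMap.range d₂).submoduleOf (LinearMap.ker d₁)

/-- The map induced in homology by a morphism of complexes. -/
def MiddleHomology.map {d₂ : M₂ →ₗ[k] M₁} {d₁ : M₁ →ₗ[k] M₀} {e₂ : N₂ →ₗ[k] N₁}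
    {e₁ : N₁ →ₗ[k] N₀} (f₂ : M₂ →ₗ[k] N₂) (f₁ : M₁ →ₗ[k] N₁) (f₀ : M₀ →ₗ[k] N₀)
    (h₂ : f₁ ∘ₗ d₂ = e₂ ∘ₗ f₂) (h₁ : f₀ ∘ₗ d₁ = e₁ ∘ₗ f₁) :
    MiddleHomology d₂ d₁ →ₗ[k] MiddleHomology e₂ e₁ :=
  Submodule.mapQ _ _
    (f₁.restrict (p := LinearMap.ker d₁) (q := LinearMap.ker e₁) fun x hx => by
      have := LinearMap.congr_fun h₁ x
      simp only [LinearMap.comp_apply] at this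
      rw [LinearMap.mem_ker] at hx ⊢
      rw [← this, hx, map_zero])
    (by
      rintro ⟨x, hx⟩ ⟨y, hy⟩
      refine ⟨f₂ y, ?_⟩
      have := LinearMap.congr_fun h₂ y
      simp only [LinearMap.comp_apply] at this
      rw [← this, hy]
      rfl)

end Homology

namespace Hochschild

section Absolute

/- A bimodule over a `k`-algebra `A` is a left module `Y` over `A` with a commuting right action,
written as a left action of the opposite algebra, such that `k` acts centrally. -/
variable (k : Type*) [Field k] (A : Type*) [Ring A] [Algebra k A]
  (Y : Type*) [AddCommGroup Y] [Module k Y] [Module A Y] [Module Aᵐᵒᵖ Y]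
  [IsScalarTower k A Y] [IsScalarTower k Aᵐᵒᵖ Y]

/-- The map `Y ⊗ A → Y`, `y ⊗ a ↦ ay`. -/
def leftAct : Y ⊗[k] A →ₗ[k] Y :=
  TensorProduct.lift (LinearMap.mk₂ k (fun (y : Y) (a : A) => a • y)
    (fun y y' a => smul_add a y y')
    (fun c y a => by rw [smul_algebra_smul_comm])
    (fun y a a' => add_smul a a' y)
    (fun c y a => smul_assoc c a y))

/-- The map `Y ⊗ A → Y`, `y ⊗ a ↦ ya`. -/
def rightAct : Y ⊗[k] A →ₗ[k] Y :=
  TensorProduct.lift (LinearMap.mk₂ k (fun (y : Y) (a : A) => MulOpposite.op a • y)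
    (fun y y' a => smul_add (MulOpposite.op a) y y')
    (fun c y a => by rw [smul_algebra_smul_comm])
    (fun y a a' => by rw [MulOpposite.op_add, add_smul])
    (fun c y a => by rw [MulOpposite.op_smul, smul_assoc]))

/-- The differential `Y ⊗ A → Y`, `y ⊗ a ↦ ya - ay`. -/
def d₁ : Y ⊗[k] A →ₗ[k] Y := rightAct k A Y - leftAct k A Y

/-- The differential `Y ⊗ A ⊗ A → Y ⊗ A`, `y ⊗ a ⊗ b ↦ ya ⊗ b - y ⊗ ab + by ⊗ a`. -/
def d₂ : (Y ⊗[k] A) ⊗[k] A →ₗ[k] Y ⊗[k] A :=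
  (rightAct k A Y).rTensor A
    - (LinearMap.mul' k A).lTensor Y ∘ₗ (TensorProduct.assoc k Y A A).toLinearMap
    + (leftAct k A Y).rTensor A ∘ₗ (TensorProduct.rightComm k Y A A).toLinearMap

@[simp]
theorem d₁_tmul (y : Y) (a : A) : d₁ k A Y (y ⊗ₜ a) = MulOpposite.op a • y - a • y := by
  simp [d₁, leftAct, rightAct]

@[simp]
theorem d₂_tmul (y : Y) (a b : A) :
    d₂ k A Y ((y ⊗ₜ a) ⊗ₜ b) =
      (MulOpposite.op a • y) ⊗ₜ[k] b - y ⊗ₜ[k] (a * b) + (b • y) ⊗ₜ[k] a := by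
  simp [d₂, leftAct, rightAct]

theorem d₁_comp_d₂ [SMulCommClass A Aᵐᵒᵖ Y] : d₁ k A Y ∘ₗ d₂ k A Y = 0 := by
  refine TensorProduct.ext_threefold fun y a b => ?_
  simp only [LinearMap.comp_apply, d₂_tmul, map_add, map_sub, d₁_tmul, MulOpposite.op_mul,
    mul_smul, LinearMap.zero_apply]
  rw [smul_comm b (MulOpposite.op a) y]
  abel

/-- The first Hochschild homology `H₁(A, Y)`. -/
abbrev H₁ : Type _ := MiddleHomology (d₂ k A Y) (d₁ k A Y)

end Absolute

/-- An `A`-bimodule `Y` seen as a `B`-bimodule along a morphism of algebras `φ : B → A`. -/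
def Restrict {k B A : Type*} [Field k] [Ring B] [Algebra k B] [Ring A] [Algebra k A]
    (_φ : B →ₐ[k] A) (Y : Type*) : Type _ := Y

section Relative

variable {k : Type*} [Field k] {B A : Type*} [Ring B] [Algebra k B] [Ring A] [Algebra k A]
  (φ : B →ₐ[k] A)
  (Y : Type*) [AddCommGroup Y] [Module k Y] [Module A Y] [Module Aᵐᵒᵖ Y]

instance : AddCommGroup (Restrict φ Y) := inferInstanceAs (AddCommGroup Y)

instance : Module k (Restrict φ Y) := inferInstanceAs (Module k Y)

instance : Module B (Restrict φ Y) := Module.compHom Y φ.toRingHom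

instance : Module Bᵐᵒᵖ (Restrict φ Y) := Module.compHom Y (RingHom.op φ.toRingHom)

/-- The identity map of `Y`, seen as a map from the restriction of `Y` to `Y`. -/
def Restrict.out : Restrict φ Y →ₗ[k] Y := LinearMap.id

theorem Restrict.out_smul (b : B) (y : Restrict φ Y) :
    Restrict.out φ Y (b • y) = φ b • Restrict.out φ Y y := rfl

theorem Restrict.out_op_smul (b : B) (y : Restrict φ Y) :
    Restrict.out φ Y (MulOpposite.op b • y) = MulOpposite.op (φ b) • Restrict.out φ Y y := rfl

theorem Restrict.out_injective : Function.Injective (Restrict.out φ Y) := fun _ _ h => h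

instance [IsScalarTower k A Y] : IsScalarTower k B (Restrict φ Y) :=
  ⟨fun c b y => Restrict.out_injective φ Y <| by
    rw [Restrict.out_smul, map_smul, map_smul, Restrict.out_smul, smul_assoc]⟩

instance [IsScalarTower k Aᵐᵒᵖ Y] : IsScalarTower k Bᵐᵒᵖ (Restrict φ Y) :=
  ⟨fun c b y => Restrict.out_injective φ Y <| by
    induction b with
    | h b =>
      rw [← MulOpposite.op_smul, Restrict.out_op_smul, map_smul, map_smul, Restrict.out_op_smul,
        MulOpposite.op_smul, smul_assoc]⟩

instance [SMulCommClass A Aᵐᵒᵖ Y] : SMulCommClass B Bᵐᵒᵖ (Restrict φ Y) :=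
  ⟨fun b c y => Restrict.out_injective φ Y <| by
    induction c with
    | h c =>
      rw [Restrict.out_smul, Restrict.out_op_smul, Restrict.out_op_smul, Restrict.out_smul,
        smul_comm]⟩

/-! ## Relative chains

Let `T` be the `n`-fold tensor product of `A` over `B`. The relative chains of degree `n` are the
tensor product of `Y` and `T` over the enveloping algebra of `B`. They are the quotient of
`Y ⊗ A ⊗ ⋯ ⊗ A` (over `k`) by the subspace `relₙ`, which allows elements of `B` to pass over each
tensor sign, and cyclically from the end to the beginning. The differential is induced by the
ordinary one. This is the complex that the relative bar resolution of `A` gives. -/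

/-- The relations in degree `0`. -/
def rel₀ : Submodule k Y :=
  Submodule.span k {z | ∃ (y : Y) (b : B), z = MulOpposite.op (φ b) • y - φ b • y}

/-- The relations in degree `1`. -/
def rel₁ : Submodule k (Y ⊗[k] A) :=
  Submodule.span k
    ({z | ∃ (y : Y) (a : A) (b : B),
        z = (MulOpposite.op (φ b) • y) ⊗ₜ[k] a - y ⊗ₜ[k] (φ b * a)} ∪
     {z | ∃ (y : Y) (a : A) (b : B),
        z = (φ b • y) ⊗ₜ[k] a - y ⊗ₜ[k] (a * φ b)})

/-- The relations in degree `2`. -/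
def rel₂ : Submodule k ((Y ⊗[k] A) ⊗[k] A) :=
  Submodule.span k
    ({z | ∃ (y : Y) (a a' : A) (b : B),
        z = ((MulOpposite.op (φ b) • y) ⊗ₜ[k] a) ⊗ₜ[k] a' - (y ⊗ₜ[k] (φ b * a)) ⊗ₜ[k] a'} ∪
     {z | ∃ (y : Y) (a a' : A) (b : B),
        z = (y ⊗ₜ[k] (a * φ b)) ⊗ₜ[k] a' - (y ⊗ₜ[k] a) ⊗ₜ[k] (φ b * a')} ∪
     {z | ∃ (y : Y) (a a' : A) (b : B),
        z = ((φ b • y) ⊗ₜ[k] a) ⊗ₜ[k] a' - (y ⊗ₜ[k] a) ⊗ₜ[k] (a' * φ b)})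

variable [IsScalarTower k A Y] [IsScalarTower k Aᵐᵒᵖ Y] [SMulCommClass A Aᵐᵒᵖ Y]

theorem rel₁_le : rel₁ φ Y ≤ (rel₀ φ Y).comap (d₁ k A Y) := by
  have r0 : ∀ (y : Y) (b : B), MulOpposite.op (φ b) • y - φ b • y ∈ rel₀ φ Y :=
    fun y b => Submodule.subset_span ⟨y, b, rfl⟩
  refine Submodule.span_le.2 ?_
  rintro z (⟨y, a, b, rfl⟩ | ⟨y, a, b, rfl⟩)
  · change d₁ k A Y _ ∈ rel₀ φ Y
    convert (rel₀ φ Y).neg_mem (r0 (a • y) b) using 1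
    simp only [map_sub, d₁_tmul, MulOpposite.op_mul, mul_smul]
    rw [smul_comm a (MulOpposite.op (φ b)) y]
    abel
  · change d₁ k A Y _ ∈ rel₀ φ Y
    convert (rel₀ φ Y).neg_mem (r0 (MulOpposite.op a • y) b) using 1
    simp only [map_sub, d₁_tmul, MulOpposite.op_mul, mul_smul]
    rw [smul_comm (φ b) (MulOpposite.op a) y]
    abel

theorem rel₂_le : rel₂ φ Y ≤ (rel₁ φ Y).comap (d₂ k A Y) := by
  have r1 : ∀ (y : Y) (a : A) (b : B),
      (MulOpposite.op (φ b) • y) ⊗ₜ[k] a - y ⊗ₜ[k] (φ b * a) ∈ rel₁ φ Y :=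
    fun y a b => Submodule.subset_span (Or.inl ⟨y, a, b, rfl⟩)
  have r2 : ∀ (y : Y) (a : A) (b : B),
      (φ b • y) ⊗ₜ[k] a - y ⊗ₜ[k] (a * φ b) ∈ rel₁ φ Y :=
    fun y a b => Submodule.subset_span (Or.inr ⟨y, a, b, rfl⟩)
  refine Submodule.span_le.2 ?_
  rintro z ((⟨y, a, a', b, rfl⟩ | ⟨y, a, a', b, rfl⟩) | ⟨y, a, a', b, rfl⟩)
  · change d₂ k A Y _ ∈ rel₁ φ Y
    convert (rel₁ φ Y).sub_mem (r1 (a' • y) a b) (r1 y (a * a') b) using 1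
    simp only [map_sub, d₂_tmul, MulOpposite.op_mul, mul_smul, mul_assoc]
    rw [smul_comm a' (MulOpposite.op (φ b)) y]
    abel
  · change d₂ k A Y _ ∈ rel₁ φ Y
    convert (rel₁ φ Y).sub_mem (r1 (MulOpposite.op a • y) a' b) (r2 (a' • y) a b) using 1
    simp only [map_sub, d₂_tmul, MulOpposite.op_mul, mul_smul, mul_assoc]
    abel
  · change d₂ k A Y _ ∈ rel₁ φ Y
    convert (rel₁ φ Y).sub_mem (r2 (MulOpposite.op a • y) a' b) (r2 y (a * a') b) using 1
    simp only [map_sub, d₂_tmul, mul_smul, mul_assoc]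
    rw [smul_comm (φ b) (MulOpposite.op a) y]
    abel

/-- The differential from the relative chains of degree `1` to those of degree `0`. -/
def relD₁ : ((Y ⊗[k] A) ⧸ rel₁ φ Y) →ₗ[k] (Y ⧸ rel₀ φ Y) :=
  Submodule.mapQ _ _ (d₁ k A Y) (rel₁_le φ Y)

/-- The differential from the relative chains of degree `2` to those of degree `1`. -/
def relD₂ : (((Y ⊗[k] A) ⊗[k] A) ⧸ rel₂ φ Y) →ₗ[k] ((Y ⊗[k] A) ⧸ rel₁ φ Y) :=
  Submodule.mapQ _ _ (d₂ k A Y) (rel₂_le φ Y)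

theorem relD₁_comp_relD₂ : relD₁ φ Y ∘ₗ relD₂ φ Y = 0 := by
  refine Submodule.linearMap_qext _ (LinearMap.ext fun x => ?_)
  have := LinearMap.congr_fun (d₁_comp_d₂ k A Y) x
  simp only [LinearMap.comp_apply, LinearMap.zero_apply] at this
  simp [relD₁, relD₂, this]

/-- The first relative Hochschild homology `H₁(A|B, Y)`. -/
abbrev RelH₁ : Type _ := MiddleHomology (relD₂ φ Y) (relD₁ φ Y)

/-- The map `H₁(B, Y) → H₁(A, Y)` induced by `φ : B → A`, that is, by `y ⊗ b ↦ y ⊗ φ(b)`. -/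
def H₁.map : H₁ k B (Restrict φ Y) →ₗ[k] H₁ k A Y :=
  MiddleHomology.map
    (TensorProduct.map (TensorProduct.map (Restrict.out φ Y) φ.toLinearMap) φ.toLinearMap)
    (TensorProduct.map (Restrict.out φ Y) φ.toLinearMap)
    (Restrict.out φ Y)
    (by
      refine TensorProduct.ext_threefold fun y a b => ?_
      simp [Restrict.out_smul, Restrict.out_op_smul])
    (by
      refine TensorProduct.ext' fun y a => ?_
      simp [Restrict.out_smul, Restrict.out_op_smul])

/-- The canonical map `H₁(A, Y) → H₁(A|B, Y)`, induced by the projections from the ordinary chains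
to the relative chains. -/
def H₁.toRel : H₁ k A Y →ₗ[k] RelH₁ φ Y :=
  MiddleHomology.map (rel₂ φ Y).mkQ (rel₁ φ Y).mkQ (rel₀ φ Y).mkQ rfl rfl

end Relative

end Hochschild

end

/-!
Surjectivity and exactness in the middle hold for every morphism of algebras `φ : B → A`. For an
element `b` of `B`, the relations between relative `1`-chains are, by the formula for `d₂`,
`yb ⊗ a - y ⊗ ba ≡ -(ay ⊗ b)` and `by ⊗ a - y ⊗ ab ≡ -(ya ⊗ b)` modulo boundaries of `A`, hence they
come from chains of `B` (`Hochschild.rel₁_le_sup`). Conversely, `y ⊗ b` is congruent to `yb ⊗ 1`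
modulo the relations, and `y ⊗ 1 = d₂(y ⊗ 1 ⊗ 1)`, so the chains of `B` become boundaries among the
relative chains (`Hochschild.range_chainMap_le`). Both facts together give exactness in the middle.
For surjectivity, a relative `1`-cycle is lifted to a chain of `A`; its differential is a sum of
elements `yb - by`, so the chain can be corrected to a cycle by a chain of `B`.

Injectivity is the statement that derivations extend. Let `W` be the quotient of `Y ⊗ B` by the
boundaries. Then `b ↦ (y ↦ [y ⊗ b])` is a derivation of `B` with values in the bimodule `Hom(Y, W)`
(`Hochschild.classMap_mul`). An extension of it to a derivation of `A` is a map `Y ⊗ A → W` which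
kills the boundaries of `A` and is the projection on `Y ⊗ B`; in its presence, a cycle of `B` that
becomes a boundary of `A` is a boundary of `B` (`Hochschild.H₁.map_injective`).

For `A = B_F` every derivation of `B` extends. A derivation is a morphism of algebras into a trivial
square-zero extension, and `B_F` has the universal property of an algebra obtained from `B` by the
free adjunction of the arrows `a` with `a = t(a) a s(a)` (`ExtendedAlgebra.exists_lift`), so that
morphisms of algebras from `B_F` lift along surjections once they do so on `B`
(`ExtendedAlgebra.exists_section`).
-/

open scoped TensorProduct

noncomputable section

/-! ### The universal property of the path algebra -/

namespace PathAlgebra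

section Lift

variable {k : Type*} [Field k] {V : Type*} [Quiver V] {R : Type*} [Ring R] [Algebra k R]

/-- The product in `R` along a path, for given values `e` on the vertices and `x` on the arrows. -/
def pathValue (e : V → R) (x : ∀ ⦃a b : V⦄, (a ⟶ b) → R) {a : V} :
    ∀ {b : V}, Quiver.Path a b → R
  | _, .nil => e a
  | _, .cons p f => x f * pathValue e x p

variable {e : V → R} {x : ∀ ⦃a b : V⦄, (a ⟶ b) → R}

theorem vertex_mul_pathValue (he : ∀ v, e v * e v = e v)
    (hl : ∀ ⦃a b : V⦄ (f : a ⟶ b), e b * x f = x f) {a b : V} (p : Quiver.Path a b) :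
    e b * pathValue e x p = pathValue e x p := by
  cases p with
  | nil => exact he a
  | cons p f => rw [pathValue, ← mul_assoc, hl]

theorem pathValue_mul_vertex (he : ∀ v, e v * e v = e v) {a b : V} (p : Quiver.Path a b) :
    pathValue e x p * e a = pathValue e x p := by
  induction p with
  | nil => exact he a
  | cons p f ih => rw [pathValue, mul_assoc, ih]

theorem pathValue_comp (he : ∀ v, e v * e v = e v)
    (hl : ∀ ⦃a b : V⦄ (f : a ⟶ b), e b * x f = x f) {a b c : V}
    (p : Quiver.Path a b) (q : Quiver.Path b c) :
    pathValue e x (p.comp q) = pathValue e x q * pathValue e x p := by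
  induction q with
  | nil => exact (vertex_mul_pathValue he hl p).symm
  | cons q f ih => rw [Quiver.Path.comp_cons, pathValue, pathValue, ih, mul_assoc]

theorem vertex_mul_self (v : V) : vertex k v * vertex k v = vertex k v :=
  single_mul_single_comp _ _

theorem vertex_mul_of_ne {v w : V} (h : v ≠ w) : vertex k v * vertex k w = 0 :=
  single_mul_single_of_ne h.symm _ _

theorem vertex_mul_single {a b : V} (p : Quiver.Path a b) :
    vertex k b * single k ⟨a, b, p⟩ = single k ⟨a, b, p⟩ :=
  single_mul_single_comp _ _

theorem single_mul_vertex {a b : V} (p : Quiver.Path a b) :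
    single k ⟨a, b, p⟩ * vertex k a = single k ⟨a, b, p⟩ := by
  rw [vertex, single_mul_single_comp, Quiver.Path.nil_comp]

variable [Fintype V]

variable (k) in
/-- The universal property of the path algebra: a complete family of orthogonal idempotents `e v`
indexed by the vertices, together with an element `x f` of `e b * R` for each arrow `f : a ⟶ b`,
extends to a morphism of algebras. The arrow `f` is sent to `x f * e a`, so that no condition at the
source of the arrow is needed. -/
def lift (e : V → R) (x : ∀ ⦃a b : V⦄, (a ⟶ b) → R) (he : ∀ v, e v * e v = e v)
    (ho : ∀ v w, v ≠ w → e v * e w = 0) (h1 : ∑ v, e v = 1)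
    (hl : ∀ ⦃a b : V⦄ (f : a ⟶ b), e b * x f = x f) : PathAlgebra k V →ₐ[k] R :=
  AlgHom.ofLinearMap (extend fun p => pathValue e x p.2.2)
    (by
      rw [one_def, map_sum, ← h1]
      refine Finset.sum_congr rfl fun v _ => ?_
      rw [vertex, extend_single, pathValue])
    (by
      set L : PathAlgebra k V →ₗ[k] R := extend fun p => pathValue e x p.2.2 with hL
      have h : mulBilin.compr₂ L = (LinearMap.mul k R).compl₁₂ L L := by
        refine hom_ext fun p => hom_ext fun q => ?_
        obtain ⟨b', c, p⟩ := p
        obtain ⟨a, b, q⟩ := q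
        simp only [LinearMap.compr₂_apply, LinearMap.compl₁₂_apply, ← mul_def,
          LinearMap.mul_apply']
        by_cases hb : b = b'
        · subst hb
          rw [single_mul_single_comp, hL]
          simp only [extend_single]
          exact pathValue_comp he hl q p
        · rw [single_mul_single_of_ne hb, map_zero, hL]
          simp only [extend_single]
          rw [← pathValue_mul_vertex he p, ← vertex_mul_pathValue he hl q, mul_assoc,
            ← mul_assoc (e b'), ho b' b (Ne.symm hb), zero_mul, mul_zero]
      exact fun a b => congrArg (fun f => f a b) h)

variable (e x) in
theorem lift_single (he ho h1 hl) {a b : V} (p : Quiver.Path a b) :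
    lift k e x he ho h1 hl (single k ⟨a, b, p⟩) = pathValue e x p :=
  extend_single (k := k) (fun p : QuiverPath V => pathValue e x p.2.2) ⟨a, b, p⟩

theorem algHom_ext {f g : PathAlgebra k V →ₐ[k] R} (hv : ∀ v, f (vertex k v) = g (vertex k v))
    (ha : ∀ ⦃a b : V⦄ (h : a ⟶ b), f (single k ⟨a, b, h.toPath⟩) = g (single k ⟨a, b, h.toPath⟩)) :
    f = g := by
  refine AlgHom.toLinearMap_injective (hom_ext ?_)
  rintro ⟨a, b, p⟩
  simp only [AlgHom.toLinearMap_apply]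
  induction p with
  | nil => exact hv a
  | cons p h ih =>
    have : Quiver.Path.cons p h = p.comp h.toPath := rfl
    rw [this, ← single_mul_single_comp, map_mul, map_mul, ih, ha]

end Lift

end PathAlgebra

/-! ### The universal property of `B_F` -/

namespace ExtendedAlgebra

open PathAlgebra AddArrows

variable {k : Type*} [Field k] {V : Type*} [Fintype V] [Quiver V]
  (I : TwoSidedIdeal (PathAlgebra k V)) {F : Type*} (s t : F → V)
  {R : Type*} [Ring R] [Algebra k R]

/-- The class in `B_F` of a new arrow. -/
def newArrow (f : F) : ExtendedAlgebra I s t :=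
  Ideal.Quotient.mk (extendedIdeal I s t).asIdeal
    (single k ⟨(incl s t).obj (s f), (incl s t).obj (t f),
      Quiver.Hom.toPath (V := AddArrows s t) (Sum.inr ⟨f, rfl, rfl⟩)⟩)

theorem vertex_mul_newArrow_mul_vertex (f : F) :
    extendedIncl I s t (QuiverAlgebra.vertex I (t f)) * newArrow I s t f *
      extendedIncl I s t (QuiverAlgebra.vertex I (s f)) = newArrow I s t f := by
  have hv (v : V) : extendedIncl I s t (QuiverAlgebra.vertex I v) =
      Ideal.Quotient.mk (extendedIdeal I s t).asIdeal
        (PathAlgebra.vertex k (V := AddArrows s t) ((incl s t).obj v)) :=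
    congrArg (Ideal.Quotient.mk (extendedIdeal I s t).asIdeal) (pathInclLinear_single s t k .nil)
  rw [hv, hv, newArrow, ← map_mul, ← map_mul, vertex_mul_single, single_mul_vertex]

/-- A morphism of algebras out of `B_F` is determined by its restriction to `B` and its values on
the new arrows. -/
theorem algHom_ext {f g : ExtendedAlgebra I s t →ₐ[k] R}
    (hB : f.comp (extendedIncl I s t) = g.comp (extendedIncl I s t))
    (hF : ∀ a, f (newArrow I s t a) = g (newArrow I s t a)) : f = g := by
  have hp {a b : V} (p : Quiver.Path a b) :
      f (Ideal.Quotient.mk _ (single k ⟨(incl s t).obj a, (incl s t).obj b, (incl s t).mapPath p⟩))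
        = g (Ideal.Quotient.mk _
          (single k ⟨(incl s t).obj a, (incl s t).obj b, (incl s t).mapPath p⟩)) := by
    rw [← pathInclLinear_single]
    exact DFunLike.congr_fun hB (Ideal.Quotient.mk I.asIdeal (single k ⟨a, b, p⟩))
  refine Ideal.Quotient.algHom_ext _ (PathAlgebra.algHom_ext (fun v => hp (a := v) .nil) ?_)
  rintro a b (h | ⟨c, rfl, rfl⟩)
  · exact hp (Quiver.Hom.toPath h)
  · exact hF c

/-- The universal property of `B_F`: a morphism of algebras `B → R` extends to `B_F` with any
prescribed values on the new arrows, once these are cut down by the idempotents of their target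
and source. -/
theorem exists_lift (ψ : QuiverAlgebra I →ₐ[k] R) (r : F → R) :
    ∃ Ψ : ExtendedAlgebra I s t →ₐ[k] R, Ψ.comp (extendedIncl I s t) = ψ ∧
      ∀ f, Ψ (newArrow I s t f) =
        ψ (QuiverAlgebra.vertex I (t f)) * r f * ψ (QuiverAlgebra.vertex I (s f)) := by
  let ψ' : PathAlgebra k V →ₐ[k] R := ψ.comp (Ideal.Quotient.mkₐ k I.asIdeal)
  let e (v : V) : R := ψ' (PathAlgebra.vertex k v)
  let x : ∀ ⦃a b : AddArrows s t⦄, (a ⟶ b) → R := fun a b =>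
    Sum.elim (fun h => ψ' (single k ⟨a, b, Quiver.Hom.toPath (V := V) h⟩)) fun c => e b * r c.1
  have he (v : V) : e v * e v = e v := by
    rw [← map_mul, vertex_mul_self]
  have ho (v w : V) (h : v ≠ w) : e v * e w = 0 := by
    rw [← map_mul, vertex_mul_of_ne h, map_zero]
  have h1 : ∑ v, e v = 1 := by
    rw [← map_sum, ← one_def, map_one]
  have hp {a b : V} (p : Quiver.Path a b) : e b * ψ' (single k ⟨a, b, p⟩) =
      ψ' (single k ⟨a, b, p⟩) := by
    rw [← map_mul, vertex_mul_single]
  have hp' {a b : V} (p : Quiver.Path a b) : ψ' (single k ⟨a, b, p⟩) * e a =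
      ψ' (single k ⟨a, b, p⟩) := by
    rw [← map_mul, single_mul_vertex]
  have hl : ∀ ⦃a b : AddArrows s t⦄ (h : a ⟶ b), e b * x h = x h := by
    rintro a b (h | c)
    · exact hp _
    · exact (mul_assoc _ _ _).symm.trans (congrArg (· * r c.1) (he b))
  let Φ : PathAlgebra k (AddArrows s t) →ₐ[k] R := lift k (V := AddArrows s t) e x he ho h1 hl
  have hΦ : Φ.comp (pathIncl s t k) = ψ' := by
    refine PathAlgebra.algHom_ext (fun v => ?_) fun a b h => ?_
    · change Φ (pathInclLinear s t k (single k ⟨v, v, .nil⟩)) = _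
      rw [pathInclLinear_single]
      exact lift_single _ _ _ _ _ _ _
    · change Φ (pathInclLinear s t k (single k ⟨a, b, h.toPath⟩)) = _
      rw [pathInclLinear_single]
      exact (lift_single _ _ _ _ _ _ _).trans (hp' _)
  have hI : ∀ z ∈ (extendedIdeal I s t).asIdeal, Φ z = 0 := by
    have : extendedIdeal I s t ≤ TwoSidedIdeal.ker Φ := by
      refine TwoSidedIdeal.span_le.2 ?_
      rintro _ ⟨z, hz, rfl⟩
      refine (TwoSidedIdeal.mem_ker Φ).2 ((DFunLike.congr_fun hΦ z).trans ?_)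
      change ψ (Ideal.Quotient.mk I.asIdeal z) = 0
      rw [Ideal.Quotient.eq_zero_iff_mem.2 (TwoSidedIdeal.mem_asIdeal.2 hz), map_zero]
    exact fun z hz => (TwoSidedIdeal.mem_ker Φ).1 (this (TwoSidedIdeal.mem_asIdeal.1 hz))
  refine ⟨Ideal.Quotient.liftₐ _ Φ hI, Ideal.Quotient.algHom_ext _ hΦ, fun f => ?_⟩
  exact lift_single (V := AddArrows s t) e x he ho h1 hl
    (Quiver.Hom.toPath (V := AddArrows s t) (Sum.inr ⟨f, rfl, rfl⟩))

/-- The algebra `B_F` is projective relative to `B`: over any surjection onto `B_F`, a lift of the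
inclusion of `B` extends to a section. -/
theorem exists_section (π : R →ₐ[k] ExtendedAlgebra I s t) (hπ : Function.Surjective π)
    (ψ : QuiverAlgebra I →ₐ[k] R) (hψ : π.comp ψ = extendedIncl I s t) :
    ∃ Ψ : ExtendedAlgebra I s t →ₐ[k] R, Ψ.comp (extendedIncl I s t) = ψ ∧
      π.comp Ψ = AlgHom.id k _ := by
  choose r hr using fun f => hπ (newArrow I s t f)
  obtain ⟨Ψ, hB, hF⟩ := exists_lift I s t ψ r
  refine ⟨Ψ, hB, algHom_ext I s t ?_ fun f => ?_⟩
  · rw [AlgHom.comp_assoc, hB, hψ, AlgHom.id_comp]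
  · have hv (v : V) : π (ψ (QuiverAlgebra.vertex I v)) = extendedIncl I s t (.vertex I v) :=
      DFunLike.congr_fun hψ _
    rw [AlgHom.comp_apply, hF, map_mul, map_mul, hr, hv, hv, vertex_mul_newArrow_mul_vertex]
    rfl

end ExtendedAlgebra

/-! ### Classes of cycles -/

namespace MiddleHomology

variable {k : Type*} [Field k]
  {M₂ M₁ M₀ : Type*} [AddCommGroup M₂] [Module k M₂] [AddCommGroup M₁] [Module k M₁]
  [AddCommGroup M₀] [Module k M₀] {d₂ : M₂ →ₗ[k] M₁} {d₁ : M₁ →ₗ[k] M₀}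

/-- The homology class of a cycle. -/
def mk (d₂ : M₂ →ₗ[k] M₁) {d₁ : M₁ →ₗ[k] M₀} (x : M₁) (hx : d₁ x = 0) : MiddleHomology d₂ d₁ :=
  Submodule.Quotient.mk ⟨x, hx⟩

theorem exists_mk (c : MiddleHomology d₂ d₁) : ∃ x hx, mk d₂ x hx = c := by
  obtain ⟨⟨x, hx⟩, rfl⟩ := Submodule.Quotient.mk_surjective _ c
  exact ⟨x, hx, rfl⟩

theorem mk_eq_zero {x : M₁} (hx : d₁ x = 0) : mk d₂ x hx = 0 ↔ x ∈ LinearMap.range d₂ :=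
  Submodule.Quotient.mk_eq_zero _

theorem mk_eq_mk {x y : M₁} (hx : d₁ x = 0) (hy : d₁ y = 0) :
    mk d₂ x hx = mk d₂ y hy ↔ x - y ∈ LinearMap.range d₂ :=
  Submodule.Quotient.eq _

end MiddleHomology

namespace Hochschild

/-! ### Linear maps out of a bimodule -/

section HomBimodule

variable (k : Type*) [Field k] (A : Type*) (Y : Type*) [AddCommGroup Y] [Module k Y]
  (W : Type*) [AddCommGroup W] [Module k W]

/-- For an `A`-bimodule `Y` and a vector space `W`, the `A`-bimodule of the linear maps `Y → W`,
with `(a f)(y) = f(ya)` and `(f a)(y) = f(ay)`. It is a copy of the type of linear maps, so that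
these actions do not clash with those of Mathlib; `A` is an argument, so that they can be found. -/
@[nolint unusedArguments]
def HomBimodule (_A : Type*) : Type _ := Y →ₗ[k] W

namespace HomBimodule

variable {k A Y W}

instance : AddCommGroup (HomBimodule k Y W A) := inferInstanceAs (AddCommGroup (Y →ₗ[k] W))

instance : Module k (HomBimodule k Y W A) := inferInstanceAs (Module k (Y →ₗ[k] W))

variable (k A Y W) in
/-- The elements of `HomBimodule k Y W A` as linear maps. -/
def toLin : HomBimodule k Y W A →ₗ[k] Y →ₗ[k] W := LinearMap.id

@[ext]
theorem ext {f g : HomBimodule k Y W A} (h : ∀ y, toLin k A Y W f y = toLin k A Y W g y) :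
    f = g := LinearMap.ext h

variable [Ring A] [Algebra k A]

section Left

variable [Module Aᵐᵒᵖ Y] [IsScalarTower k Aᵐᵒᵖ Y]

instance : SMul A (HomBimodule k Y W A) :=
  ⟨fun a f => (toLin k A Y W f).comp (Algebra.lsmul k k Y (MulOpposite.op a))⟩

theorem smul_apply (a : A) (f : HomBimodule k Y W A) (y : Y) :
    toLin k A Y W (a • f) y = toLin k A Y W f (MulOpposite.op a • y) := rfl

instance : Module A (HomBimodule k Y W A) where
  one_smul f := by ext; simp [smul_apply]
  mul_smul a b f := by ext; simp [smul_apply, mul_smul]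
  smul_zero a := by ext; simp [smul_apply]
  smul_add a f g := by ext; simp [smul_apply]
  add_smul a b f := by ext; simp [smul_apply, add_smul]
  zero_smul f := by ext; simp [smul_apply]

instance : IsScalarTower k A (HomBimodule k Y W A) :=
  ⟨fun c a f => by ext; simp [smul_apply]⟩

end Left

section Right

variable [Module A Y] [IsScalarTower k A Y]

instance : SMul Aᵐᵒᵖ (HomBimodule k Y W A) :=
  ⟨fun a f => (toLin k A Y W f).comp (Algebra.lsmul k k Y a.unop)⟩

theorem op_smul_apply (a : Aᵐᵒᵖ) (f : HomBimodule k Y W A) (y : Y) :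
    toLin k A Y W (a • f) y = toLin k A Y W f (a.unop • y) := rfl

instance : Module Aᵐᵒᵖ (HomBimodule k Y W A) where
  one_smul f := by ext; simp [op_smul_apply]
  mul_smul a b f := by ext; simp [op_smul_apply, mul_smul]
  smul_zero a := by ext; simp [op_smul_apply]
  smul_add a f g := by ext; simp [op_smul_apply]
  add_smul a b f := by ext; simp [op_smul_apply, add_smul]
  zero_smul f := by ext; simp [op_smul_apply]

instance : IsScalarTower k Aᵐᵒᵖ (HomBimodule k Y W A) :=
  ⟨fun c a f => by ext; simp [op_smul_apply]⟩

end Right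

instance [Module A Y] [Module Aᵐᵒᵖ Y] [IsScalarTower k A Y] [IsScalarTower k Aᵐᵒᵖ Y]
    [SMulCommClass A Aᵐᵒᵖ Y] : SMulCommClass A Aᵐᵒᵖ (HomBimodule k Y W A) :=
  ⟨fun a b f => by ext y; simp [smul_apply, op_smul_apply, smul_comm b.unop (MulOpposite.op a) y]⟩

end HomBimodule

end HomBimodule

section Sequence

variable {k : Type*} [Field k] {B A : Type*} [Ring B] [Algebra k B] [Ring A] [Algebra k A]
  (φ : B →ₐ[k] A)
  (Y : Type*) [AddCommGroup Y] [Module k Y] [Module A Y] [Module Aᵐᵒᵖ Y]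
  [IsScalarTower k A Y] [IsScalarTower k Aᵐᵒᵖ Y]

/-! ### Chains of `B` inside the chains of `A` -/

/-- The map `Y ⊗ B → Y ⊗ A` on Hochschild `1`-chains that is induced by `φ : B → A`. -/
abbrev chainMap : Restrict φ Y ⊗[k] B →ₗ[k] Y ⊗[k] A :=
  TensorProduct.map (Restrict.out φ Y) φ.toLinearMap

theorem d₁_chainMap (w : Restrict φ Y ⊗[k] B) :
    d₁ k A Y (chainMap φ Y w) = Restrict.out φ Y (d₁ k B (Restrict φ Y) w) := by
  induction w with
  | zero => simp
  | add x y hx hy => simp only [map_add, hx, hy]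
  | tmul y b => simp [Restrict.out_smul, Restrict.out_op_smul]

theorem tmul_one_mem_range_d₂ (y : Y) : y ⊗ₜ[k] (1 : A) ∈ LinearMap.range (d₂ k A Y) :=
  ⟨(y ⊗ₜ 1) ⊗ₜ 1, by simp⟩

/-- The chains of `B` vanish, up to boundaries, among the relative chains: `y ⊗ b` becomes
`yb ⊗ 1`, which is a boundary. -/
theorem range_chainMap_le :
    LinearMap.range (chainMap φ Y) ≤ rel₁ φ Y ⊔ LinearMap.range (d₂ k A Y) := by
  rw [LinearMap.range_le_iff_comap, eq_top_iff, ← TensorProduct.span_tmul_eq_top, Submodule.span_le]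
  rintro _ ⟨y, b, rfl⟩
  change Y at y
  change y ⊗ₜ[k] φ b ∈ rel₁ φ Y ⊔ LinearMap.range (d₂ k A Y)
  have h1 : (MulOpposite.op (φ b) • y) ⊗ₜ[k] (1 : A) - y ⊗ₜ[k] (φ b * 1) ∈ rel₁ φ Y :=
    Submodule.subset_span (Or.inl ⟨y, 1, b, rfl⟩)
  rw [mul_one] at h1
  have h2 : (MulOpposite.op (φ b) • y) ⊗ₜ[k] (1 : A) ∈ LinearMap.range (d₂ k A Y) :=
    tmul_one_mem_range_d₂ Y _
  simpa only [sub_sub_cancel] using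
    sub_mem (Submodule.mem_sup_right h2) (Submodule.mem_sup_left h1)

/-- Up to boundaries, the relations that define the relative `1`-chains are chains of `B`. -/
theorem rel₁_le_sup : rel₁ φ Y ≤ LinearMap.range (d₂ k A Y) ⊔ LinearMap.range (chainMap φ Y) := by
  have hB (y : Y) (b : B) : y ⊗ₜ[k] φ b ∈ LinearMap.range (chainMap φ Y) :=
    ⟨TensorProduct.tmul k (M := Restrict φ Y) y b, rfl⟩
  refine Submodule.span_le.2 ?_
  rintro z (⟨y, a, b, rfl⟩ | ⟨y, a, b, rfl⟩)
  · refine Submodule.mem_sup.2 ⟨d₂ k A Y ((y ⊗ₜ φ b) ⊗ₜ a), ⟨_, rfl⟩, -((a • y) ⊗ₜ φ b),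
      neg_mem (hB _ b), ?_⟩
    rw [d₂_tmul]
    abel
  · refine Submodule.mem_sup.2 ⟨d₂ k A Y ((y ⊗ₜ a) ⊗ₜ φ b), ⟨_, rfl⟩,
      -((MulOpposite.op a • y) ⊗ₜ φ b), neg_mem (hB _ b), ?_⟩
    rw [d₂_tmul]
    abel

theorem rel₀_le_map_d₁ : rel₀ φ Y ≤ (LinearMap.range (chainMap φ Y)).map (d₁ k A Y) := by
  refine Submodule.span_le.2 ?_
  rintro _ ⟨y, b, rfl⟩
  exact ⟨y ⊗ₜ φ b, ⟨TensorProduct.tmul k (M := Restrict φ Y) y b, rfl⟩, d₁_tmul k A Y y (φ b)⟩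

/-! ### Injectivity -/

/-- The class of `y ⊗ b` modulo the boundaries, as a function of `b` with values in the linear maps
from `Y`. -/
def classMap : B →ₗ[k]
    HomBimodule k Y ((Restrict φ Y ⊗[k] B) ⧸ LinearMap.range (d₂ k B (Restrict φ Y))) A :=
  ((TensorProduct.mk k (Restrict φ Y) B).compr₂ (LinearMap.range (d₂ k B (Restrict φ Y))).mkQ).flip

theorem classMap_apply (b : B) (y : Restrict φ Y) :
    HomBimodule.toLin k A Y _ (classMap φ Y b) (Restrict.out φ Y y) =
      (LinearMap.range (d₂ k B (Restrict φ Y))).mkQ (y ⊗ₜ[k] b) := rfl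

/-- The class of `y ⊗ b` is a derivation in `b`, since boundaries vanish. -/
theorem classMap_mul (b b' : B) :
    classMap φ Y (b * b') = φ b • classMap φ Y b' + MulOpposite.op (φ b') • classMap φ Y b := by
  refine HomBimodule.ext fun y => ?_
  let z : Restrict φ Y := y
  rw [map_add, LinearMap.add_apply, HomBimodule.smul_apply, HomBimodule.op_smul_apply]
  change (LinearMap.range (d₂ k B (Restrict φ Y))).mkQ (z ⊗ₜ[k] (b * b')) =
    (LinearMap.range (d₂ k B (Restrict φ Y))).mkQ ((MulOpposite.op b • z) ⊗ₜ[k] b') +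
      (LinearMap.range (d₂ k B (Restrict φ Y))).mkQ ((b' • z) ⊗ₜ[k] b)
  rw [← map_add, eq_comm, ← sub_eq_zero, ← map_sub, Submodule.mkQ_apply,
    Submodule.Quotient.mk_eq_zero]
  refine ⟨(z ⊗ₜ b) ⊗ₜ b', ?_⟩
  rw [d₂_tmul]
  abel

theorem classMap_one : classMap φ Y 1 = 0 := by
  simpa using classMap_mul φ Y 1 1

variable [SMulCommClass A Aᵐᵒᵖ Y]

/-- The morphism `b ↦ (φ b, class of - ⊗ b)` into the trivial extension, which encodes the
derivation `classMap`. -/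
def classHom : B →ₐ[k] TrivSqZeroExt A
    (HomBimodule k Y ((Restrict φ Y ⊗[k] B) ⧸ LinearMap.range (d₂ k B (Restrict φ Y))) A) :=
  AlgHom.ofLinearMap
    ((TrivSqZeroExt.inlAlgHom k A _).toLinearMap ∘ₗ φ.toLinearMap +
      (TrivSqZeroExt.inrHom A _).restrictScalars k ∘ₗ classMap φ Y)
    (by
      ext <;> simp [classMap_one])
    (fun b b' => by
      ext1 <;> simp [classMap_mul])

theorem fstHom_comp_classHom : (TrivSqZeroExt.fstHom k A _).comp (classHom φ Y) = φ := by
  ext b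
  simp [classHom]

theorem snd_classHom (b : B) : (classHom φ Y b).snd = classMap φ Y b := by
  simp [classHom]

/-- If the morphism `classHom` extends to a section `Ψ` over `A` of the trivial extension, then
`φ : B → A` is injective on the first Hochschild homology. The second component of `Ψ` is a
derivation of `A`, thus a function on the `1`-chains of `A` that kills the boundaries, and on a
`1`-chain of `B` it is the class of that chain modulo the boundaries of `B`. -/
theorem H₁.map_injective
    (Ψ : A →ₐ[k] TrivSqZeroExt A
      (HomBimodule k Y ((Restrict φ Y ⊗[k] B) ⧸ LinearMap.range (d₂ k B (Restrict φ Y))) A))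
    (hφ : Ψ.comp φ = classHom φ Y)
    (hA : (TrivSqZeroExt.fstHom k A _).comp Ψ = AlgHom.id k A) :
    Function.Injective (H₁.map φ Y) := by
  have hA (a : A) : (Ψ a).fst = a := DFunLike.congr_fun hA a
  let D : A →ₗ[k] Y →ₗ[k] ((Restrict φ Y ⊗[k] B) ⧸ LinearMap.range (d₂ k B (Restrict φ Y))) :=
    HomBimodule.toLin k A Y _ ∘ₗ (TrivSqZeroExt.sndHom A _).restrictScalars k ∘ₗ Ψ.toLinearMap
  have hD (a b : A) (y : Y) : D (a * b) y = D b (MulOpposite.op a • y) + D a (b • y) := by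
    change HomBimodule.toLin k A Y _ (Ψ (a * b)).snd y = _
    rw [map_mul, TrivSqZeroExt.snd_mul, hA, hA, map_add]
    rfl
  let ρ := TensorProduct.lift D.flip
  have hρ : ρ ∘ₗ d₂ k A Y = 0 := by
    refine TensorProduct.ext_threefold fun y a b => ?_
    simp [ρ, hD]
  have hρB : ρ ∘ₗ chainMap φ Y = (LinearMap.range (d₂ k B (Restrict φ Y))).mkQ := by
    refine TensorProduct.ext' fun y b => ?_
    rw [← classMap_apply, ← snd_classHom, ← hφ]
    rfl
  rw [← LinearMap.ker_eq_bot, LinearMap.ker_eq_bot']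
  intro c hc
  obtain ⟨x, hx, rfl⟩ := MiddleHomology.exists_mk c
  obtain ⟨u, hu⟩ := (MiddleHomology.mk_eq_zero _).1 hc
  rw [MiddleHomology.mk_eq_zero, ← Submodule.ker_mkQ (LinearMap.range (d₂ k B (Restrict φ Y))),
    LinearMap.mem_ker, ← hρB]
  change ρ (chainMap φ Y x) = 0
  exact (congrArg ρ hu).symm.trans (LinearMap.congr_fun hρ u)

/-! ### Surjectivity and exactness in the middle -/

theorem mkQ_chainMap_mem_range_relD₂ (w : Restrict φ Y ⊗[k] B) :
    (rel₁ φ Y).mkQ (chainMap φ Y w) ∈ LinearMap.range (relD₂ φ Y) := by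
  obtain ⟨r, hr, _, ⟨u, rfl⟩, h⟩ := Submodule.mem_sup.1 (range_chainMap_le φ Y ⟨w, rfl⟩)
  refine ⟨(rel₂ φ Y).mkQ u, ?_⟩
  have hr' : (rel₁ φ Y).mkQ r = 0 := (Submodule.Quotient.mk_eq_zero _).2 hr
  rw [← h, map_add, hr', zero_add]
  rfl

theorem H₁.toRel_surjective : Function.Surjective (H₁.toRel φ Y) := by
  intro c
  obtain ⟨x, hx, rfl⟩ := MiddleHomology.exists_mk c
  obtain ⟨z, rfl⟩ := (rel₁ φ Y).mkQ_surjective x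
  have hz : d₁ k A Y z ∈ rel₀ φ Y := (Submodule.Quotient.mk_eq_zero _).1 hx
  obtain ⟨_, ⟨w, rfl⟩, hw⟩ := rel₀_le_map_d₁ φ Y hz
  refine ⟨MiddleHomology.mk _ (z - chainMap φ Y w) (by rw [map_sub, hw, sub_self]), ?_⟩
  refine (MiddleHomology.mk_eq_mk _ _).2 ?_
  change (rel₁ φ Y).mkQ (z - chainMap φ Y w) - (rel₁ φ Y).mkQ z ∈ _
  rw [map_sub, sub_sub_cancel_left]
  exact neg_mem (mkQ_chainMap_mem_range_relD₂ φ Y w)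

theorem H₁.exact_map_toRel : Function.Exact (H₁.map φ Y) (H₁.toRel φ Y) := by
  intro c
  constructor
  · intro hc
    obtain ⟨z, hz, rfl⟩ := MiddleHomology.exists_mk c
    obtain ⟨q, hq⟩ := (MiddleHomology.mk_eq_zero _).1 hc
    obtain ⟨u, rfl⟩ := (rel₂ φ Y).mkQ_surjective q
    have hr : d₂ k A Y u - z ∈ rel₁ φ Y := (Submodule.Quotient.eq _).1 hq
    obtain ⟨_, ⟨v, rfl⟩, _, ⟨w, rfl⟩, h⟩ := Submodule.mem_sup.1 (rel₁_le_sup φ Y hr)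
    have hd (v) : d₁ k A Y (d₂ k A Y v) = 0 := LinearMap.congr_fun (d₁_comp_d₂ k A Y) v
    have hw : d₁ k B (Restrict φ Y) w = 0 := by
      refine Restrict.out_injective φ Y ?_
      rw [← d₁_chainMap, map_zero]
      simpa only [map_add, map_sub, hd, hz, zero_add, sub_zero] using congrArg (d₁ k A Y) h
    refine ⟨MiddleHomology.mk _ (-w) (by rw [map_neg, hw, neg_zero]), ?_⟩
    refine (MiddleHomology.mk_eq_mk _ _).2 ⟨v - u, ?_⟩
    change _ = chainMap φ Y (-w) - z
    rw [map_neg, map_sub, ← sub_eq_iff_eq_add'.2 h.symm]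
    abel
  · rintro ⟨c, rfl⟩
    obtain ⟨w, hw, rfl⟩ := MiddleHomology.exists_mk c
    exact (MiddleHomology.mk_eq_zero _).2 (mkQ_chainMap_mem_range_relD₂ φ Y w)

end Sequence

end Hochschild

end

theorem theorem5p1 {k : Type*} [Field k] {V : Type*} [Fintype V] [Quiver V]
    [∀ a b : V, Finite (a ⟶ b)]
    (I : TwoSidedIdeal (PathAlgebra k V)) (hI : PathAlgebra.IsAdmissible I)
    {F : Type*} [Finite F] (s t : F → V) (hF : ∀ γ : List F, ¬ IsRelativeCycle I s t γ)
    (Y : Type*) [AddCommGroup Y] [Module k Y]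
    [Module (ExtendedAlgebra I s t) Y] [Module (ExtendedAlgebra I s t)ᵐᵒᵖ Y]
    [IsScalarTower k (ExtendedAlgebra I s t) Y] [IsScalarTower k (ExtendedAlgebra I s t)ᵐᵒᵖ Y]
    [SMulCommClass (ExtendedAlgebra I s t) (ExtendedAlgebra I s t)ᵐᵒᵖ Y]
    [Module.Finite k Y] :
    Function.Injective (Hochschild.H₁.map (extendedIncl I s t) Y) ∧
      Function.Exact (Hochschild.H₁.map (extendedIncl I s t) Y)
        (Hochschild.H₁.toRel (extendedIncl I s t) Y) ∧
      Function.Surjective (Hochschild.H₁.toRel (extendedIncl I s t) Y) := by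
  refine ⟨?_, Hochschild.H₁.exact_map_toRel _ Y, Hochschild.H₁.toRel_surjective _ Y⟩
  obtain ⟨Ψ, hB, hA⟩ := ExtendedAlgebra.exists_section I s t (TrivSqZeroExt.fstHom k _ _)
    TrivSqZeroExt.fst_surjective (Hochschild.classHom (extendedIncl I s t) Y)
    (Hochschild.fstHom_comp_classHom _ Y)
  exact Hochschild.H₁.map_injective _ Y Ψ hB hA
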